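/- For $n\ge 1$ let $\Psi_{2n}$ be the convex hull of the symmetric $2n\times 2n$ permutation matrices with zero diagonal. For a real symmetric $2n\times 2n$ matrix $B=[b_{ij}]$ with zero diagonal and $0\le k\le n$, let $\mathrm{haf}_k(B)$ be the sum of the hafnians of all principal submatrices of $B$ of order $2k$, where the hafnian of a symmetric matrix of even order is the sum, over all perfect matchings $M$ of the complete graph on its index set, of $\prod_{\{i,j\}\in M} b_{ij}$. Equivalently, $\mathrm{haf}_k(B)$ is the total weight of all $k$-matchings of the complete graph $K_{2n}$ with edge weights $b_{ij}$. Let $n\ge 1$, and suppose that $B\in\Psi_{2n}$ has exactly one positive eigenvalue, counted with multiplicity. Then $$\mathrm{haf}_n(B)\ \ge\ \Big(\frac{n-1}{n}\Big)^{(n-1)n}$$ (where $0^0=1$ for $n=1$), and for every $k=2,\ldots,n-1$ $$\mathrm{haf}_k(B)\ \ge\ \frac{(2n)^{2n-2k}\,(2n-k)!\,(2n)^k}{(2n-2k)!\,(2n-k)^{2n-k}\,2^k\,k!}\Big(\frac{2n-k-1}{2n-k}\Big)^{(2n-k-1)k}.$$ Moreover, $\big(\frac{n-1}{n}\big)^{(n-1)n}\sim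 e^{-n}\sqrt e$ as $n\to\infty$, i.e. the ratio of the two sides tends to $1$. -/

import Mathlib

/-- The perfect matchings of the complete graph on a finite linearly ordered vertex set `V`.
The edge between `i` and `j` with `i < j` is represented by the ordered pair `(i, j)`; a perfect
matching is a set of edges such that every vertex lies on exactly one of them. -/
def perfectMatchings (V : Type*) [Fintype V] [LinearOrder V] : Finset (Finset (V × V)) :=
  Finset.univ.filter fun M =>
    (∀ e ∈ M, e.1 < e.2) ∧ ∀ v : V, (M.filter fun e => v = e.1 ∨ v = e.2).card = 1

/-- The hafnian of a (symmetric) matrix `B`: the sum over all perfect matchings of the product of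
the weights `B i j` of the edges of the matching. -/
def haf {R V : Type*} [CommSemiring R] [Fintype V] [LinearOrder V] (B : Matrix V V R) : R :=
  ∑ M ∈ perfectMatchings V, ∏ e ∈ M, B e.1 e.2

/-- `haf_k(B)`: the sum of the hafnians of all principal submatrices of `B` of order `2k`. -/
def hafK {R V : Type*} [CommSemiring R] [Fintype V] [LinearOrder V] (k : ℕ)
    (B : Matrix V V R) : R :=
  ∑ S ∈ Finset.powersetCard (2 * k) (Finset.univ : Finset V),
    haf (B.submatrix (fun i : S => (i : V)) (fun i : S => (i : V)))

/-- `Ψ_{2n}`: the convex hull of the symmetric `2n × 2n` permutation matrices with zero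
diagonal. -/
def Psi (n : ℕ) : Set (Matrix (Fin (2 * n)) (Fin (2 * n)) ℝ) :=
  convexHull ℝ {P | (∃ σ : Equiv.Perm (Fin (2 * n)), P = σ.permMatrix ℝ) ∧
    P.IsSymm ∧ ∀ i, P i i = 0}

/-- The real matrix `B` has exactly one positive eigenvalue, eigenvalues being counted with
multiplicity as roots of the characteristic polynomial. -/
def HasExactlyOnePosEigenvalue {V : Type*} [Fintype V] [DecidableEq V]
    (B : Matrix V V ℝ) : Prop :=
  (B.charpoly.roots.filter fun t : ℝ => 0 < t).card = 1

/-! The argument is Gurvits' capacity method. Put `l = 2n - 2k` and let `p` be the product of the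
`k`-th power of the quadratic form `∑_{i<j} b_ij x_i x_j` and the `l`-th power of `∑ x_i`. The
coefficient of `x_1 ⋯ x_{2n}` in `p` is `k! l! haf_k(B)`, so a lower bound for this coefficient is
needed.

One positive eigenvalue makes the quadratic form satisfy a reversed Cauchy-Schwarz inequality, and
with nonnegative entries this makes it stable for the right half-plane: `q(Re z) ≤ |q(z)|`. Products
inherit this, so `p` is stable. Since `B` is doubly stochastic, weighted AM-GM gives `p(x) ≥ n^k
(2n)^l ∏ x_j` for positive `x`, a bound on the capacity.

The variables are then eliminated one by one. Passing to the coefficient of `x_i` preserves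
stability (Gauss-Lucas and a minimum modulus argument) and costs the capacity at most
`((d-1)/d)^(d-1)`, where `d` bounds the degree in `x_i` (real-rootedness and AM-GM). Here `d` is the
minimum of the individual bound `2n - k` and the current total degree; multiplying the factors gives
the constant. The main steps are `IsStableForm.linearCoeff`,
`IsStableForm.capacity_mul_prod_le_coeff` and `coeff_edgeForm_pow_mul`. -/

/-! ### Univariate estimates from root locations -/

open Polynomial in
theorem Polynomial.norm_eval_zero_le_norm_eval_one {F : ℂ[X]}
    (h : ∀ a, F.IsRoot a → a.re ≤ 1 / 2) : ‖F.eval 0‖ ≤ ‖F.eval 1‖ := by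
  by_cases hF : F = 0
  · simp [hF]
  have hs := IsAlgClosed.splits F
  rw [hs.eval_eq_prod_roots, hs.eval_eq_prod_roots, norm_mul, norm_mul]
  refine mul_le_mul_of_nonneg_left ?_ (norm_nonneg _)
  have hr : ∀ a ∈ F.roots, a.re ≤ 1 / 2 := fun a ha => h a (isRoot_of_mem_roots ha)
  generalize F.roots = m at hr
  induction m using Multiset.induction_on with
  | empty => simp
  | cons a m ih =>
    simp only [Multiset.map_cons, Multiset.prod_cons, norm_mul]
    -- A point with real part at most `1/2` is no farther from `0` than from `1`.
    refine mul_le_mul ?_ (ih fun b hb => hr b (Multiset.mem_cons_of_mem hb)) (norm_nonneg _)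
      (norm_nonneg _)
    have := hr a (Multiset.mem_cons_self a m)
    rw [← sq_le_sq₀ (norm_nonneg _) (norm_nonneg _), Complex.sq_norm, Complex.sq_norm,
      Complex.normSq_apply, Complex.normSq_apply]
    simp
    nlinarith

-- By Gauss-Lucas, a critical point at `0` would be a convex combination of roots, all in the open
-- left half-plane.
open Polynomial in
theorem Polynomial.eval_derivative_zero_ne_zero {F : ℂ[X]} (hF : 0 < F.degree)
    (h : ∀ a, F.IsRoot a → a.re < 0) : F.derivative.eval 0 ≠ 0 := by
  intro h0
  have h1 := eq_centerMass_of_eval_derivative_eq_zero hF h0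
  have hc : Convex ℝ {z : ℂ | z.re < 0} := convex_halfSpace_re_lt 0
  have := hc.centerMass_mem (t := F.roots.toFinset) (w := F.derivRootWeight 0) (z := id)
    (fun i _ => derivRootWeight_nonneg F 0 i) (sum_derivRootWeight_pos hF 0)
    (fun i hi => h i (isRoot_of_mem_roots (Multiset.mem_toFinset.1 hi)))
  rw [← h1] at this
  simp at this

theorem Multiset.prod_le_pow_mul_exp {u : ℝ} (hu : 0 < u) (m : Multiset ℝ)
    (hm : ∀ b ∈ m, 0 ≤ b) :
    m.prod ≤ u ^ Multiset.card m * Real.exp (m.sum / u - Multiset.card m) := by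
  induction m using Multiset.induction_on with
  | empty => simp
  | cons b m ih =>
    have ih := ih fun b hb => hm b (Multiset.mem_cons_of_mem hb)
    have hb := hm b (Multiset.mem_cons_self b m)
    have h1 : b ≤ u * Real.exp (b / u - 1) := by
      have := Real.add_one_le_exp (b / u - 1)
      rw [sub_add_cancel, div_le_iff₀ hu] at this
      linarith
    have h2 : 0 ≤ m.prod := Multiset.prod_nonneg fun b hb => hm b (Multiset.mem_cons_of_mem hb)
    rw [Multiset.prod_cons, Multiset.sum_cons, Multiset.card_cons]
    calc b * m.prod ≤ (u * Real.exp (b / u - 1)) *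
          (u ^ Multiset.card m * Real.exp (m.sum / u - Multiset.card m)) :=
          mul_le_mul h1 ih h2 (by positivity)
      _ = _ := by
        rw [mul_mul_mul_comm, ← Real.exp_add, ← pow_succ']
        congr 2
        push_cast
        ring

/-- The arithmetic-geometric mean inequality for a multiset padded with ones. -/
theorem Multiset.prod_le_mean_pow (m : Multiset ℝ) (hm : ∀ b ∈ m, 1 ≤ b) {d : ℕ}
    (hd : Multiset.card m ≤ d) (hd0 : 0 < d) :
    m.prod ≤ (1 + (m.sum - Multiset.card m) / d) ^ d := by
  have hs : (Multiset.card m : ℝ) ≤ m.sum := by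
    have := Multiset.card_nsmul_le_sum (s := m) (a := (1 : ℝ)) hm
    simpa using this
  have hd' : (0 : ℝ) < d := by exact_mod_cast hd0
  set u := 1 + (m.sum - Multiset.card m) / d with hu
  have hu1 : 1 ≤ u := by
    rw [hu, le_add_iff_nonneg_right]
    exact div_nonneg (by linarith) hd'.le
  have hu0 : 0 < u := by linarith
  have hsum : m.sum = Multiset.card m + d * (u - 1) := by
    rw [hu]; field_simp; ring
  refine (Multiset.prod_le_pow_mul_exp hu0 m fun b hb => zero_le_one.trans (hm b hb)).trans ?_
  -- `u` is the mean after padding with ones up to `d` entries; this inequality pays for each of the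
  -- `r` ones.
  have he : Real.exp (1 - 1 / u) ≤ u := by
    rw [← Real.le_log_iff_exp_le hu0]
    simpa using Real.one_sub_inv_le_log_of_pos hu0
  obtain ⟨r, rfl⟩ := Nat.exists_eq_add_of_le hd
  rw [pow_add]
  refine mul_le_mul_of_nonneg_left ?_ (by positivity)
  calc Real.exp (m.sum / u - Multiset.card m) = Real.exp (1 - 1 / u) ^ r := by
        rw [← Real.exp_nat_mul, hsum]
        congr 1
        push_cast
        field_simp
        ring
    _ ≤ u ^ r := pow_le_pow_left₀ (Real.exp_pos _).le he r

/-- The factor lost by the capacity when one variable of degree at most `d` is eliminated. -/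
noncomputable def capacityFactor (d : ℕ) : ℝ := (((d : ℝ) - 1) / d) ^ (d - 1)

theorem capacityFactor_nonneg (d : ℕ) : 0 ≤ capacityFactor d := by
  rcases Nat.eq_zero_or_pos d with rfl | hd
  · simp [capacityFactor]
  · have : (1 : ℝ) ≤ d := by exact_mod_cast hd
    exact pow_nonneg (div_nonneg (by linarith) (by linarith)) _

theorem capacityFactor_pos {d : ℕ} (hd : 0 < d) : 0 < capacityFactor d := by
  rcases Nat.eq_or_lt_of_le (show 1 ≤ d from hd) with rfl | hd
  · simp [capacityFactor]
  · have : (2 : ℝ) ≤ d := by exact_mod_cast hd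
    exact pow_pos (div_pos (by linarith) (by linarith)) _

theorem capacityFactor_le_one (d : ℕ) : capacityFactor d ≤ 1 := by
  rcases Nat.eq_zero_or_pos d with rfl | hd
  · simp [capacityFactor]
  · have : (1 : ℝ) ≤ d := by exact_mod_cast hd
    refine pow_le_one₀ (div_nonneg (by linarith) (by linarith)) ?_
    rw [div_le_one (by linarith)]
    linarith

theorem capacityFactor_mul_le {d : ℕ} (hd : 0 < d) {a s c : ℝ} (ha : 0 < a) (hs : 0 ≤ s)
    (h : ∀ t, 0 < t → c * t ≤ a * (1 + s * t / d) ^ d) : capacityFactor d * c ≤ a * s := by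
  have hd1 : (1 : ℝ) ≤ d := by exact_mod_cast hd
  by_cases hc : c ≤ 0
  · exact (mul_nonpos_of_nonneg_of_nonpos (capacityFactor_nonneg d) hc).trans
      (mul_nonneg ha.le hs)
  push Not at hc
  by_cases hd2 : d = 1
  · subst hd2
    have hf : capacityFactor 1 = 1 := by simp [capacityFactor]
    rw [hf, one_mul]
    by_contra hlt
    push Not at hlt
    have := h ((a + 1) / (c - a * s)) (div_pos (by linarith) (by linarith))
    have h3 : (c - a * s) * ((a + 1) / (c - a * s)) = a + 1 := by
      exact mul_div_cancel₀ _ (sub_pos.2 hlt).ne'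
    simp only [Nat.cast_one, div_one, pow_one] at this
    nlinarith
  have hd3 : (2 : ℝ) ≤ d := by exact_mod_cast (show 2 ≤ d by omega)
  rcases hs.eq_or_lt with rfl | hs
  · have := h ((a + 1) / c) (by positivity)
    rw [mul_div_cancel₀ _ hc.ne'] at this
    simp at this
    linarith
  have hdd : (0 : ℝ) < d - 1 := by linarith
  -- This `t` minimises `(1 + s t / d)^d / t`. For `d = 1` or `s = 0` there is no minimiser, and
  -- large `t` was used instead.
  have := h (d / (s * (d - 1))) (by positivity)
  have e1 : 1 + s * (d / (s * (d - 1))) / d = (((d : ℝ) - 1) / d)⁻¹ := by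
    field_simp
    ring
  rw [e1] at this
  set g : ℝ := ((d : ℝ) - 1) / d with hg
  have hg0 : 0 < g := by positivity
  have e2 : c * (d / (s * (d - 1))) = c / (s * g) := by
    rw [hg]; field_simp
  rw [e2, div_le_iff₀ (by positivity)] at this
  have e3 : g ^ d = g ^ (d - 1) * g := by rw [← pow_succ, Nat.sub_add_cancel hd]
  rw [inv_pow, e3] at this
  rw [capacityFactor, ← hg]
  have e4 : a * (g ^ (d - 1) * g)⁻¹ * (s * g) = a * s / g ^ (d - 1) := by
    field_simp
  rw [e4, le_div_iff₀ (by positivity)] at this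
  linarith

-- All roots are real and nonpositive. If `R(0) > 0`, then `R(t) = R(0) ∏ (1 + t b_i)` with `b_i ≥
-- 0` and `∑ b_i = R'(0)/R(0)`; AM-GM bounds this by a `d`-th power, and `t` is optimised. If `R(0)
-- = 0`, the difference quotients already give `R'(0) ≥ c`.
open Polynomial in
theorem Polynomial.capacityFactor_mul_le_eval_derivative {R : ℝ[X]} {d : ℕ} {c : ℝ} (hc : 0 < c)
    (hd : R.natDegree ≤ d) (hR : ∀ a : ℂ, aeval a R = 0 → a.im = 0 ∧ a.re ≤ 0)
    (h : ∀ t, 0 < t → c * t ≤ R.eval t) :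
    capacityFactor d * c ≤ R.derivative.eval 0 := by
  have hpos : ∀ t, 0 < t → 0 < R.eval t := fun t ht => (mul_pos hc ht).trans_le (h t ht)
  have hs : R.Splits := by
    refine Splits.of_splits_map (algebraMap ℝ ℂ) (IsAlgClosed.splits _) fun a ha => ?_
    have := hR a (by simpa [aeval_def, eval_map] using isRoot_of_mem_roots ha)
    exact ⟨a.re, Complex.ext (by simp) (by simp [this.1])⟩
  have hroot : ∀ a ∈ R.roots, a ≤ 0 := fun a ha => by
    simpa using (hR a (by
      have := isRoot_of_mem_roots ha
      have h2 : aeval (algebraMap ℝ ℂ a) R = algebraMap ℝ ℂ (R.eval a) := by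
        rw [aeval_algebraMap_apply]; rfl
      rw [this.eq_zero, map_zero] at h2
      exact h2)).2
  have hge : 0 ≤ R.eval 0 := by
    refine ge_of_tendsto (x := nhdsWithin 0 (Set.Ioi 0)) (f := fun t => R.eval t)
      (R.continuous.tendsto 0 |>.mono_left nhdsWithin_le_nhds) ?_
    filter_upwards [self_mem_nhdsWithin] with t ht using (hpos t ht).le
  rcases hge.eq_or_lt with h0 | h0
  · have hcR : c ≤ R.derivative.eval 0 := by
      have hder := (R.hasDerivAt 0).tendsto_slope_zero_right
      refine ge_of_tendsto hder ?_
      filter_upwards [self_mem_nhdsWithin] with t (ht : 0 < t)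
      rw [zero_add, ← h0, sub_zero, smul_eq_mul, inv_mul_eq_div, le_div_iff₀ ht]
      exact h t ht
    exact (mul_le_of_le_one_left hc.le (capacityFactor_le_one d)).trans hcR
  have hd0 : 0 < d := by
    by_contra hd0
    have : R.natDegree = 0 := by omega
    rw [eq_C_of_natDegree_eq_zero this] at h
    have := h ((|R.coeff 0| + 1) / c) (by positivity)
    rw [mul_div_cancel₀ _ hc.ne', eval_C] at this
    linarith [le_abs_self (R.coeff 0)]
  have hroot' : ∀ a ∈ R.roots, a < 0 := fun a ha => by
    refine lt_of_le_of_ne (hroot a ha) ?_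
    rintro rfl
    exact h0.ne' (isRoot_of_mem_roots ha)
  have hder := hs.eval_derivative_eq_eval_mul_sum h0.ne'
  rw [hder]
  refine capacityFactor_mul_le hd0 h0 ?_ fun t ht => (h t ht).trans ?_
  · refine Multiset.sum_nonneg fun b hb => ?_
    obtain ⟨a, ha, rfl⟩ := Multiset.mem_map.1 hb
    have := hroot' a ha
    exact div_nonneg zero_le_one (by linarith)
  · have key := Multiset.prod_le_mean_pow (R.roots.map fun a => 1 + 1 / (0 - a) * t) (d := d)
      (fun b hb => by
        obtain ⟨a, ha, rfl⟩ := Multiset.mem_map.1 hb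
        have := hroot' a ha
        have : 0 ≤ 1 / (0 - a) * t := mul_nonneg (div_nonneg zero_le_one (by linarith)) ht.le
        linarith)
      (by rw [Multiset.card_map]; exact (card_roots' R).trans hd) hd0
    have e1 : R.eval t = R.eval 0 * (R.roots.map fun a => 1 + 1 / (0 - a) * t).prod := by
      rw [hs.eval_eq_prod_roots t, hs.eval_eq_prod_roots 0, mul_assoc, ← Multiset.prod_map_mul]
      congr 2
      refine Multiset.map_congr rfl fun a ha => ?_
      have := (hroot' a ha).ne
      field_simp
      ring
    rw [e1]
    refine mul_le_mul_of_nonneg_left (key.trans_eq ?_) h0.le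
    congr 3
    rw [Multiset.sum_map_add, Multiset.sum_map_mul_right]
    simp

/-! ### Evaluation, slices and linear coefficients -/

namespace MvPolynomial

section Finite

variable {V : Type*} [Fintype V]

theorem aeval_eq_sum_support {A : Type*} [CommRing A] [Algebra ℝ A] (w : V → A)
    (p : MvPolynomial V ℝ) :
    aeval w p = ∑ m ∈ p.support, algebraMap ℝ A (p.coeff m) * ∏ j, w j ^ m j := by
  rw [aeval_def, eval₂_eq']

theorem IsHomogeneous.sum_eq {p : MvPolynomial V ℝ} {e : ℕ} (hp : p.IsHomogeneous e)
    {m : V →₀ ℕ} (hm : m ∈ p.support) : ∑ j, m j = e := by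
  rw [← Finsupp.degree_eq_sum]
  by_contra h
  exact mem_support_iff.1 hm (hp.coeff_eq_zero h)

theorem IsHomogeneous.aeval_mul {A : Type*} [CommRing A] [Algebra ℝ A] {p : MvPolynomial V ℝ}
    {e : ℕ} (hp : p.IsHomogeneous e) (c : A) (w : V → A) :
    MvPolynomial.aeval (fun j => c * w j) p = c ^ e * MvPolynomial.aeval w p := by
  rw [aeval_eq_sum_support, aeval_eq_sum_support, Finset.mul_sum]
  refine Finset.sum_congr rfl fun m hm => ?_
  simp_rw [mul_pow]
  rw [Finset.prod_mul_distrib, Finset.prod_pow_eq_pow_sum, hp.sum_eq hm]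
  ring

theorem aeval_nonneg {p : MvPolynomial V ℝ} (hp : ∀ m, 0 ≤ p.coeff m) {x : V → ℝ}
    (hx : ∀ j, 0 ≤ x j) : 0 ≤ aeval x p := by
  rw [aeval_eq_sum_support]
  exact Finset.sum_nonneg fun m _ =>
    mul_nonneg (hp m) (Finset.prod_nonneg fun j _ => pow_nonneg (hx j) _)

theorem aeval_eq_zero_of_nonneg {p : MvPolynomial V ℝ} (hp : ∀ m, 0 ≤ p.coeff m) {x : V → ℝ}
    (hx : ∀ j, 0 ≤ x j) (h0 : aeval x p = 0) {z : V → ℂ} (hz : ∀ j, x j = 0 → z j = 0) :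
    aeval z p = 0 := by
  rw [aeval_eq_sum_support] at h0 ⊢
  have h0 := (Finset.sum_eq_zero_iff_of_nonneg fun m _ =>
    mul_nonneg (hp m) (Finset.prod_nonneg fun j _ => pow_nonneg (hx j) _)).1 h0
  refine Finset.sum_eq_zero fun m hm => ?_
  rcases mul_eq_zero.1 (h0 m hm) with h | h
  · exact absurd h (by simpa using hm)
  · obtain ⟨j, hj, h⟩ := Finset.prod_eq_zero_iff.1 h
    rw [pow_eq_zero_iff'] at h
    exact mul_eq_zero_of_right _ (Finset.prod_eq_zero hj (by rw [hz j h.1, zero_pow h.2]))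

theorem continuous_aeval_complex (p : MvPolynomial V ℝ) :
    Continuous fun z : V → ℂ => aeval z p := by
  simp_rw [aeval_eq_sum_support]
  fun_prop

theorem continuous_aeval_real (p : MvPolynomial V ℝ) :
    Continuous fun z : V → ℝ => aeval z p := by
  simp_rw [aeval_eq_sum_support]
  fun_prop

end Finite

section Slice

variable {V : Type*} [DecidableEq V]

/-- The univariate polynomial obtained from `p` by fixing all variables but the `i`-th. -/
noncomputable def slice {A : Type*} [CommRing A] [Algebra ℝ A] (i : V) (w : V → A)
    (p : MvPolynomial V ℝ) : Polynomial A :=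
  aeval (Function.update (fun j => Polynomial.C (w j)) i Polynomial.X) p

/-- The coefficient of `X i` in `p`, seen as a polynomial in `X i`. -/
noncomputable def linearCoeff (i : V) (p : MvPolynomial V ℝ) : MvPolynomial V ℝ :=
  aeval (Function.update X i 0) (pderiv i p)

theorem aeval_slice {A B : Type*} [CommRing A] [Algebra ℝ A] [CommRing B] [Algebra ℝ B]
    [Algebra A B] [IsScalarTower ℝ A B] (i : V) (w : V → A) (p : MvPolynomial V ℝ) (t : B) :
    Polynomial.aeval t (slice i w p) =
      aeval (Function.update (fun j => algebraMap A B (w j)) i t) p := by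
  have := comp_aeval_apply (Function.update (fun j => Polynomial.C (w j)) i Polynomial.X)
    ((Polynomial.aeval (R := A) t).restrictScalars ℝ) p
  rw [slice]
  refine this.trans ?_
  congr 2
  ext j
  by_cases h : j = i
  · subst h; simp
  · simp [h]

theorem eval_slice {A : Type*} [CommRing A] [Algebra ℝ A] (i : V) (w : V → A)
    (p : MvPolynomial V ℝ) (t : A) :
    (slice i w p).eval t = aeval (Function.update w i t) p := by
  have := aeval_slice (B := A) i w p t
  simpa using this

theorem derivative_slice {A : Type*} [CommRing A] [Algebra ℝ A] (i : V) (w : V → A)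
    (p : MvPolynomial V ℝ) :
    Polynomial.derivative (slice i w p) = slice i w (pderiv i p) := by
  unfold slice
  induction p using MvPolynomial.induction_on with
  | C a =>
    rw [pderiv_C, map_zero, algHom_C, Polynomial.algebraMap_apply, Polynomial.derivative_C]
  | add p q hp hq => simp only [map_add, hp, hq]
  | mul_X p j hp =>
    rw [Derivation.leibniz, pderiv_X, map_mul, Polynomial.derivative_mul, hp]
    simp only [map_add, smul_eq_mul, map_mul, aeval_X]
    by_cases h : j = i
    · subst h; simp; ring
    · simp [h, mul_comm]

theorem aeval_linearCoeff {A : Type*} [CommRing A] [Algebra ℝ A] (i : V) (w : V → A)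
    (p : MvPolynomial V ℝ) :
    aeval w (linearCoeff i p) = (slice i w p).derivative.eval 0 := by
  rw [derivative_slice, eval_slice, linearCoeff, comp_aeval_apply]
  congr 2
  ext j
  by_cases h : j = i
  · subst h; simp
  · simp [h]

theorem coeff_aeval_update_zero (i : V) (p : MvPolynomial V ℝ) (m : V →₀ ℕ) :
    (aeval (Function.update X i 0) p : MvPolynomial V ℝ).coeff m =
      if m i = 0 then p.coeff m else 0 := by
  induction p using MvPolynomial.induction_on' with
  | monomial u a =>
    by_cases hu : u i = 0
    · have : (aeval (Function.update X i 0) (monomial u a) : MvPolynomial V ℝ) = monomial u a := by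
        rw [aeval_monomial, monomial_eq]
        congr 1
        refine Finset.prod_congr rfl fun j hj => ?_
        have : j ≠ i := by
          rintro rfl
          exact (Finsupp.mem_support_iff.1 hj) hu
        simp [this]
      rw [this, coeff_monomial]
      by_cases h : u = m
      · subst h; simp [hu]
      · simp [h]
    · have : (aeval (Function.update X i 0) (monomial u a) : MvPolynomial V ℝ) = 0 := by
        rw [aeval_monomial]
        refine mul_eq_zero_of_right _ (Finset.prod_eq_zero (Finsupp.mem_support_iff.2 hu) ?_)
        simp [hu]
      rw [this, coeff_monomial]
      by_cases h : u = m
      · subst h; simp [hu]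
      · simp [h]
  | add p q hp hq =>
    rw [map_add, coeff_add, coeff_add, hp, hq]
    split_ifs <;> simp

theorem coeff_linearCoeff (i : V) (p : MvPolynomial V ℝ) (m : V →₀ ℕ) :
    (linearCoeff i p).coeff m = if m i = 0 then p.coeff (m + Finsupp.single i 1) else 0 := by
  rw [linearCoeff, coeff_aeval_update_zero, coeff_pderiv]
  split_ifs with h <;> simp [h]

theorem IsHomogeneous.linearCoeff {p : MvPolynomial V ℝ} {e : ℕ} (hp : p.IsHomogeneous (e + 1))
    (i : V) : (linearCoeff i p).IsHomogeneous e := by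
  have h := (hp.pderiv (i := i)).aeval (Function.update X i 0 : V → MvPolynomial V ℝ) (n := 1)
    fun j => by
      by_cases h : j = i
      · subst h; simpa using isHomogeneous_zero _ _ _
      · simpa [h] using isHomogeneous_X _ _
  simpa [MvPolynomial.linearCoeff] using h

variable [Fintype V]

theorem natDegree_slice_le {A : Type*} [CommRing A] [Algebra ℝ A] (i : V) (w : V → A)
    {p : MvPolynomial V ℝ} {d : ℕ} (h : ∀ m ∈ p.support, m i ≤ d) :
    (slice i w p).natDegree ≤ d := by
  rw [slice, aeval_eq_sum_support]
  refine Polynomial.natDegree_sum_le_of_forall_le _ _ fun m hm => ?_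
  rw [Polynomial.algebraMap_apply]
  refine (Polynomial.natDegree_C_mul_le _ _).trans ((Polynomial.natDegree_prod_le _ _).trans ?_)
  refine le_trans (Finset.sum_le_sum (g := fun j => if j = i then m j else 0) fun j _ => ?_) ?_
  · refine Polynomial.natDegree_pow_le.trans ?_
    by_cases hj : j = i
    · subst hj
      simpa using mul_le_mul_right (Polynomial.natDegree_X_le (R := A)) (m j)
    · simp [hj]
  · simpa using h m hm

theorem coeff_slice_nonneg (i : V) {x : V → ℝ} (hx : ∀ j, 0 ≤ x j) {p : MvPolynomial V ℝ}
    (hp : ∀ m, 0 ≤ p.coeff m) (k : ℕ) : 0 ≤ (slice i x p).coeff k := by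
  have hmul : ∀ P Q : Polynomial ℝ, (∀ k, 0 ≤ P.coeff k) → (∀ k, 0 ≤ Q.coeff k) →
      ∀ k, 0 ≤ (P * Q).coeff k := fun P Q hP hQ k => by
    rw [Polynomial.coeff_mul]
    exact Finset.sum_nonneg fun a _ => mul_nonneg (hP _) (hQ _)
  have hC : ∀ a : ℝ, 0 ≤ a → ∀ k, 0 ≤ (Polynomial.C a).coeff k := fun a ha k => by
    rw [Polynomial.coeff_C]; split_ifs <;> simp [ha]
  have hone : ∀ k, 0 ≤ (1 : Polynomial ℝ).coeff k := hC 1 zero_le_one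
  rw [slice, aeval_eq_sum_support, Polynomial.finsetSum_coeff]
  refine Finset.sum_nonneg fun m _ => hmul _ _ (hC _ (hp m)) ?_ k
  refine Finset.prod_induction _ (fun P : Polynomial ℝ => ∀ k, 0 ≤ P.coeff k) hmul hone
    fun j _ => ?_
  have hj : ∀ k, 0 ≤ (Function.update (fun j => Polynomial.C (x j)) i Polynomial.X j).coeff k := by
    by_cases hj : j = i
    · subst hj
      intro k
      rw [Function.update_self, Polynomial.coeff_X]
      split_ifs <;> simp
    · rw [Function.update_of_ne hj]
      exact hC _ (hx j)
  generalize m j = r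
  induction r with
  | zero => simpa using hone
  | succ r ih => rw [pow_succ]; exact hmul _ _ ih hj

/-- As a polynomial in the `i`-th variable, `p` has nonnegative coefficients, so it dominates its
first two terms. -/
theorem aeval_linearCoeff_mul_le (i : V) {x : V → ℝ} (hx : ∀ j, 0 ≤ x j)
    {p : MvPolynomial V ℝ} (hp : ∀ m, 0 ≤ p.coeff m) {t : ℝ} (ht : 0 ≤ t) :
    aeval (Function.update x i 0) p + aeval x (linearCoeff i p) * t ≤
      aeval (Function.update x i t) p := by
  have hc := coeff_slice_nonneg i hx hp
  rw [aeval_linearCoeff, ← eval_slice, ← eval_slice]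
  generalize slice i x p = P at hc
  rw [← Polynomial.coeff_zero_eq_eval_zero, ← Polynomial.coeff_zero_eq_eval_zero,
    Polynomial.coeff_derivative,
    Polynomial.eval_eq_sum_range' (n := P.natDegree + 2) (by omega)]
  rw [Finset.sum_range_succ', Finset.sum_range_succ']
  have : 0 ≤ ∑ k ∈ Finset.range P.natDegree, P.coeff (k + 1 + 1) * t ^ (k + 1 + 1) :=
    Finset.sum_nonneg fun k _ => mul_nonneg (hc _) (pow_nonneg ht _)
  simp only [zero_add, pow_one, pow_zero, mul_one, Nat.cast_zero]
  linarith

end Slice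

end MvPolynomial

/-! ### Stable forms and the capacity inequality -/

namespace MvPolynomial

theorem aeval_ofReal {V : Type*} (p : MvPolynomial V ℝ) (x : V → ℝ) :
    aeval (fun j => (x j : ℂ)) p = ((aeval x p : ℝ) : ℂ) :=
  aeval_algebraMap_apply ℂ x p

variable {V : Type*} [Fintype V]

/-- A homogeneous polynomial of degree `e` with nonnegative coefficients which is stable with
respect to the right half-plane, expressed by the inequality `p (Re z) ≤ ‖p z‖`. -/
structure IsStableForm (p : MvPolynomial V ℝ) (e : ℕ) : Prop where
  coeff_nonneg : ∀ m, 0 ≤ p.coeff m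
  isHomogeneous : p.IsHomogeneous e
  le_norm_of_pos : ∀ z : V → ℂ, (∀ j, 0 < (z j).re) → aeval (fun j => (z j).re) p ≤ ‖aeval z p‖

theorem IsStableForm.le_norm {p : MvPolynomial V ℝ} {e : ℕ} (hp : p.IsStableForm e) {z : V → ℂ}
    (hz : ∀ j, 0 ≤ (z j).re) : aeval (fun j => (z j).re) p ≤ ‖aeval z p‖ := by
  have h1 : Continuous fun t : ℝ => (fun j => z j + (t : ℂ)) := by fun_prop
  have h2 : Continuous fun t : ℝ => (fun j => (z j).re + t) := by fun_prop
  have l1 := ((continuous_aeval_complex p).comp h1).norm.tendsto 0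
  have l2 := ((continuous_aeval_real p).comp h2).tendsto 0
  simp only [Function.comp_def, Complex.ofReal_zero, add_zero] at l1 l2
  refine le_of_tendsto_of_tendsto (l2.mono_left (nhdsWithin_le_nhds (s := Set.Ioi 0)))
    (l1.mono_left nhdsWithin_le_nhds) ?_
  filter_upwards [self_mem_nhdsWithin] with t (ht : 0 < t)
  simpa using hp.le_norm_of_pos (fun j => z j + (t : ℂ)) fun j => by
    have := hz j
    simp only [Complex.add_re, Complex.ofReal_re]
    linarith

/-- A homogeneous polynomial without zeros in the fibre of `Re` over a positive vector `x` attains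
its minimal modulus over that fibre at `x`. -/
theorem IsHomogeneous.norm_aeval_le_of_ne_zero {p : MvPolynomial V ℝ} {e : ℕ}
    (hp : p.IsHomogeneous e) {x : V → ℝ}
    (h : ∀ z : V → ℂ, (∀ j, (z j).re = x j) → MvPolynomial.aeval z p ≠ 0) {z : V → ℂ}
    (hz : ∀ j, (z j).re = x j) :
    ‖MvPolynomial.aeval (fun j => (x j : ℂ)) p‖ ≤ ‖MvPolynomial.aeval z p‖ := by
  set F : Polynomial ℂ := MvPolynomial.aeval (fun j => Polynomial.C (x j : ℂ) +
    Polynomial.C (Complex.I * (z j).im) * Polynomial.X) p with hF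
  have hev : ∀ s, F.eval s = MvPolynomial.aeval (fun j => x j + Complex.I * (z j).im * s) p := by
    intro s
    have := comp_aeval_apply (fun j => Polynomial.C (x j : ℂ) +
      Polynomial.C (Complex.I * (z j).im) * Polynomial.X)
      ((Polynomial.aeval (R := ℂ) s).restrictScalars ℝ) p
    rw [← hF] at this
    simpa using this
  have hroot : ∀ a, F.IsRoot a → a.re ≤ 1 / 2 := by
    intro a ha
    by_contra! hlt
    have ha0 : a ≠ 0 := by
      rintro rfl
      norm_num at hlt
    have hre : a⁻¹.re ≠ 0 := by
      rw [Complex.inv_re]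
      exact div_ne_zero (by linarith) (Complex.normSq_pos.2 ha0).ne'
    -- `F` runs along the line from `x` at `s = 0` to `z` at `s = 1`. This scaling moves the zero
    -- given by `a` back into the fibre over `x`; it only needs `Re a ≠ 0`.
    have h0 := hp.aeval_mul (a⁻¹ / (a⁻¹.re : ℂ)) fun j => (x j : ℂ) + Complex.I * (z j).im * a
    rw [← hev, ha.eq_zero, mul_zero] at h0
    refine h _ (fun j => ?_) h0
    have : a⁻¹ / (a⁻¹.re : ℂ) * (x j + Complex.I * (z j).im * a) =
        a⁻¹ * ((x j / a⁻¹.re : ℝ) : ℂ) + ((((z j).im) / a⁻¹.re : ℝ) : ℂ) * Complex.I := by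
      have : (a⁻¹.re : ℂ) ≠ 0 := by exact_mod_cast hre
      push_cast
      generalize (a⁻¹.re : ℂ) = c at this
      field_simp
    rw [this, Complex.add_re, Complex.re_mul_ofReal, Complex.re_ofReal_mul, Complex.I_re, mul_zero,
      add_zero, mul_div_cancel₀ _ hre]
  have key := Polynomial.norm_eval_zero_le_norm_eval_one hroot
  rw [hev, hev] at key
  convert key using 4
  · simp
  · ext j
    apply Complex.ext <;> simp [hz j]

variable [DecidableEq V]

/-- Stability gives `|P(t)| ≥ p(x with x_i = 0) + r Re t` for the slice `P` at `z`, with `r > 0`. If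
the constant term vanishes, so does `P(0)`, and `|P'(0)| ≥ r`. Otherwise `P` is nonconstant without
roots in the closed right half-plane, and Gauss-Lucas applies. -/
theorem IsStableForm.aeval_linearCoeff_ne_zero {p : MvPolynomial V ℝ} {e : ℕ}
    (hp : p.IsStableForm e) (i : V) {x : V → ℝ} (hx : ∀ j, 0 < x j)
    (hr : 0 < aeval x (linearCoeff i p)) {z : V → ℂ} (hz : ∀ j, (z j).re = x j) :
    aeval z (linearCoeff i p) ≠ 0 := by
  have hx0 : ∀ j, 0 ≤ x j := fun j => (hx j).le
  have hre : ∀ t : ℂ, (fun j => (Function.update z i t j).re) = Function.update x i t.re := by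
    intro t
    ext j
    by_cases h : j = i
    · subst h; simp
    · simp [h, hz]
  have hlow : ∀ t : ℂ, 0 ≤ t.re → aeval (Function.update x i t.re) p ≤
      ‖(slice i z p).eval t‖ := by
    intro t ht
    rw [eval_slice, ← hre]
    refine hp.le_norm fun j => ?_
    have := congrFun (hre t) j
    rw [this]
    by_cases h : j = i
    · subst h; simpa using ht
    · simpa [h] using hx0 j
  have hx' : ∀ j, 0 ≤ Function.update x i 0 j := fun j => by
    by_cases h : j = i
    · subst h; simp
    · simpa [h] using hx0 j
  have hgrow : ∀ t : ℂ, 0 ≤ t.re →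
      aeval (Function.update x i 0) p + aeval x (linearCoeff i p) * t.re ≤
        ‖(slice i z p).eval t‖ := fun t ht =>
    (aeval_linearCoeff_mul_le i hx0 hp.coeff_nonneg ht).trans (hlow t ht)
  have hnn := aeval_nonneg hp.coeff_nonneg hx'
  rw [aeval_linearCoeff]
  rcases hnn.eq_or_lt with h0 | h0
  · have hz0 : (slice i z p).eval 0 = 0 := by
      rw [eval_slice]
      refine aeval_eq_zero_of_nonneg hp.coeff_nonneg hx' h0.symm fun j hj => ?_
      by_cases h : j = i
      · subst h; simp
      · simp only [Function.update_of_ne h] at hj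
        exact absurd hj (hx j).ne'
    have hder : HasDerivAt (fun t : ℝ => (slice i z p).eval (t : ℂ))
        ((slice i z p).derivative.eval 0) 0 := by
      have := ((slice i z p).hasDerivAt ((0 : ℝ) : ℂ)).comp_ofReal
      simpa using this
    have hlim := hder.tendsto_slope_zero_right.norm
    intro hc
    have : aeval x (linearCoeff i p) ≤ ‖(slice i z p).derivative.eval 0‖ := by
      refine ge_of_tendsto hlim ?_
      filter_upwards [self_mem_nhdsWithin] with t (ht : 0 < t)
      have := hgrow t (by simpa using ht.le)
      rw [← h0, zero_add, Complex.ofReal_re] at this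
      rw [zero_add, Complex.ofReal_zero, hz0, sub_zero, norm_smul, norm_inv,
        Real.norm_of_nonneg ht.le, inv_mul_eq_div, le_div_iff₀ ht]
      exact this
    rw [hc, norm_zero] at this
    linarith
  · refine Polynomial.eval_derivative_zero_ne_zero ?_ fun a ha => ?_
    · rw [← Polynomial.natDegree_pos_iff_degree_pos]
      by_contra hdeg
      have hC := Polynomial.eq_C_of_natDegree_eq_zero (p := slice i z p) (by omega)
      rw [hC] at hgrow
      set b := ‖(slice i z p).coeff 0‖ with hb
      have hb0 : 0 ≤ b := norm_nonneg _
      have := hgrow ((b / aeval x (linearCoeff i p) : ℝ) : ℂ) (by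
        rw [Complex.ofReal_re]; positivity)
      rw [Complex.ofReal_re, Polynomial.eval_C, ← hb, mul_div_cancel₀ _ hr.ne'] at this
      linarith
    · by_contra! hlt
      have := hgrow a hlt
      rw [ha.eq_zero, norm_zero] at this
      have := mul_nonneg hr.le hlt
      linarith

theorem IsStableForm.linearCoeff {p : MvPolynomial V ℝ} {e : ℕ} (hp : p.IsStableForm (e + 1))
    (i : V) : (linearCoeff i p).IsStableForm e := by
  have hc : ∀ m, 0 ≤ (MvPolynomial.linearCoeff i p).coeff m := fun m => by
    rw [coeff_linearCoeff]
    split_ifs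
    · exact hp.coeff_nonneg _
    · exact le_rfl
  have hh := hp.isHomogeneous.linearCoeff i
  refine ⟨hc, hh, fun z hz => ?_⟩
  rcases (aeval_nonneg hc fun j => (hz j).le).eq_or_lt with h0 | h0
  · rw [← h0]; exact norm_nonneg _
  have := hh.norm_aeval_le_of_ne_zero
    (fun w hw => hp.aeval_linearCoeff_ne_zero i hz h0 hw) (z := z) fun j => rfl
  rw [aeval_ofReal, Complex.norm_real] at this
  exact (le_abs_self _).trans this

theorem IsStableForm.roots_slice {p : MvPolynomial V ℝ} {e : ℕ} (hp : p.IsStableForm e)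
    (hpos : ∀ x : V → ℝ, (∀ j, 0 < x j) → 0 < aeval x p) (i : V) {x : V → ℝ}
    (hx : ∀ j, 0 < x j) {a : ℂ} (ha : Polynomial.aeval a (slice i x p) = 0) :
    a.im = 0 ∧ a.re ≤ 0 := by
  rw [aeval_slice] at ha
  by_contra hcon
  have hlt : 0 < ‖a‖ + a.re := by
    by_contra! hle
    have h1 := Complex.abs_re_le_norm a
    have h2 : a.re ≤ 0 := by linarith [norm_nonneg a]
    refine hcon ⟨?_, h2⟩
    have h3 : ‖a‖ = |a.re| := le_antisymm (by rw [abs_of_nonpos h2]; linarith) h1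
    exact Complex.abs_re_eq_norm.1 h3.symm
  -- Unless `a` lies on the nonpositive real axis, this factor rotates both `1` and `a` into the
  -- open right half-plane, where stability forbids zeros.
  set c : ℂ := ‖a‖ + (starRingEnd ℂ) a with hc
  have hcre : c.re = ‖a‖ + a.re := by simp [hc]
  have ha0 : 0 < ‖a‖ := by
    rw [norm_pos_iff]
    rintro rfl
    simp at hlt
  have hcare : (c * a).re = ‖a‖ * (‖a‖ + a.re) := by
    have : c * a = ‖a‖ * a + (starRingEnd ℂ) a * a := by rw [hc]; ring
    rw [this, mul_comm ((starRingEnd ℂ) a) a, Complex.mul_conj, Complex.normSq_eq_norm_sq, Complex.add_re,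
      Complex.re_ofReal_mul, Complex.ofReal_re]
    ring
  have h0 := hp.isHomogeneous.aeval_mul c
    (Function.update (fun j => algebraMap ℝ ℂ (x j)) i a)
  rw [ha, mul_zero] at h0
  have hw : ∀ j, 0 < (c * Function.update (fun j => algebraMap ℝ ℂ (x j)) i a j).re := by
    intro j
    by_cases h : j = i
    · subst h
      rw [Function.update_self, hcare]
      positivity
    · rw [Function.update_of_ne h, Complex.coe_algebraMap, Complex.re_mul_ofReal, hcre]
      exact mul_pos hlt (hx j)
  have h1 := hp.le_norm_of_pos _ hw
  rw [h0, norm_zero] at h1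
  exact absurd (hpos _ hw) (not_lt.2 h1)

theorem IsStableForm.capacityFactor_mul_le_aeval_linearCoeff {p : MvPolynomial V ℝ} {e d : ℕ}
    (hp : p.IsStableForm e) (i : V) (hd : ∀ m ∈ p.support, m i ≤ d) {T : Finset V} (hi : i ∉ T)
    {c : ℝ} (hc : 0 < c)
    (hcap : ∀ x : V → ℝ, (∀ j, 0 < x j) → c * ∏ j ∈ insert i T, x j ≤ aeval x p)
    {x : V → ℝ} (hx : ∀ j, 0 < x j) :
    capacityFactor (min d e) * c * ∏ j ∈ T, x j ≤ aeval x (MvPolynomial.linearCoeff i p) := by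
  rw [aeval_linearCoeff, mul_assoc]
  refine Polynomial.capacityFactor_mul_le_eval_derivative
    (mul_pos hc (Finset.prod_pos fun j _ => hx j)) ?_ (fun a ha => ?_) fun t ht => ?_
  · refine natDegree_slice_le i x fun m hm => le_min (hd m hm) ?_
    rw [← hp.isHomogeneous.sum_eq hm]
    exact Finset.single_le_sum (f := fun j => m j) (fun _ _ => Nat.zero_le _) (Finset.mem_univ i)
  · refine hp.roots_slice (fun y hy => ?_) i hx ha
    exact (mul_pos hc (Finset.prod_pos fun j _ => hy j)).trans_le (hcap y hy)
  · rw [eval_slice]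
    refine le_of_eq_of_le ?_ (hcap (Function.update x i t) fun j => ?_)
    · rw [Finset.prod_insert hi, Function.update_self, Finset.prod_update_of_notMem hi]
      ring
    · by_cases h : j = i
      · subst h; simpa using ht
      · simpa [h] using hx j

/-- The capacity bound for the coefficient of the product of the variables in `T`. -/
theorem IsStableForm.capacity_mul_prod_le_coeff (d : ℕ) (hd : 0 < d) (T : Finset V) :
    ∀ (p : MvPolynomial V ℝ), p.IsStableForm T.card → (∀ m ∈ p.support, ∀ i, m i ≤ d) →
      ∀ c : ℝ, 0 < c →
      (∀ x : V → ℝ, (∀ j, 0 < x j) → c * ∏ j ∈ T, x j ≤ aeval x p) →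
      c * ∏ k ∈ Finset.range T.card, capacityFactor (min d (k + 1)) ≤
        p.coeff (∑ j ∈ T, Finsupp.single j 1) := by
  induction T using Finset.induction_on with
  | empty =>
    intro p hp _ c _ hcap
    have h := hcap (fun _ => 1) fun _ => one_pos
    have hC := totalDegree_eq_zero_iff_eq_C.1
      ((totalDegree_zero_iff_isHomogeneous V).2 (by simpa using hp.isHomogeneous))
    rw [hC] at h
    simpa using h
  | insert i T hi ih =>
    intro p hp hdeg c hc hcap
    rw [Finset.card_insert_of_notMem hi] at hp
    have hstep := fun {x : V → ℝ} => hp.capacityFactor_mul_le_aeval_linearCoeff i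
      (fun m hm => hdeg m hm i) hi hc hcap (x := x)
    -- The total degree is now `T.card + 1` and drops by one with each elimination, hence the
    -- varying minimum with `d`.
    have hpos : 0 < capacityFactor (min d (T.card + 1)) := capacityFactor_pos (by omega)
    have := ih _ (hp.linearCoeff i) (fun m hm j => ?_) (capacityFactor (min d (T.card + 1)) * c)
      (by positivity) fun x hx => hstep hx
    · rw [coeff_linearCoeff, if_pos] at this
      · rw [Finset.card_insert_of_notMem hi, Finset.prod_range_succ, Finset.sum_insert hi,
          add_comm (Finsupp.single i 1)]
        refine le_of_eq_of_le (by ring) this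
      · rw [Finsupp.finsetSum_apply]
        refine Finset.sum_eq_zero fun j hj => ?_
        rw [Finsupp.single_apply, if_neg]
        rintro rfl
        exact hi hj
    · rw [mem_support_iff, coeff_linearCoeff] at hm
      have h : m + Finsupp.single i 1 ∈ p.support := by
        rw [mem_support_iff]
        intro h0
        simp [h0] at hm
      exact le_trans (by simp) (hdeg _ h j)

end MvPolynomial

/-! ### Quadratic forms with one positive eigenvalue -/

section Lorentzian

variable {V : Type*} [Fintype V]

/-- Take for `φ` the coordinate along the eigenvector of the positive eigenvalue; the remaining
squares have nonpositive weights. -/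
theorem HasExactlyOnePosEigenvalue.exists_nonpos_on_ker [DecidableEq V] {B : Matrix V V ℝ}
    (hB : B.IsSymm) (h : HasExactlyOnePosEigenvalue B) :
    ∃ φ : (V → ℝ) →ₗ[ℝ] ℝ, ∀ w, φ w = 0 → w ⬝ᵥ B.mulVec w ≤ 0 := by
  have hH : B.IsHermitian := by
    rw [Matrix.IsHermitian, Matrix.conjTranspose_eq_transpose_of_trivial]; exact hB
  have hcard : (Finset.univ.filter fun i => 0 < hH.eigenvalues i).card = 1 := by
    have h1 : (B.charpoly.roots.filter fun t : ℝ => 0 < t).card = 1 := h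
    rw [hH.roots_charpoly_eq_eigenvalues, Multiset.filter_map, Multiset.card_map] at h1
    exact h1
  obtain ⟨i₀, hi₀⟩ := Finset.card_eq_one.1 hcard
  set U : Matrix V V ℝ := (hH.eigenvectorUnitary : Matrix V V ℝ)
  have hspec : B = U * Matrix.diagonal hH.eigenvalues * U.transpose := by
    have := hH.spectral_theorem
    rw [Unitary.conjStarAlgAut_apply] at this
    exact this
  refine ⟨(LinearMap.proj i₀).comp (Matrix.mulVecLin U.transpose), fun w hw => ?_⟩
  have hw' : U.transpose.mulVec w i₀ = 0 := hw
  have hq : w ⬝ᵥ B.mulVec w = ∑ i, hH.eigenvalues i * U.transpose.mulVec w i ^ 2 := by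
    conv_lhs => rw [hspec]
    rw [← Matrix.mulVec_mulVec, ← Matrix.mulVec_mulVec, Matrix.dotProduct_mulVec,
      ← Matrix.mulVec_transpose, dotProduct]
    refine Finset.sum_congr rfl fun i _ => ?_
    rw [Matrix.mulVec_diagonal]
    ring
  rw [hq]
  refine Finset.sum_nonpos fun i _ => ?_
  by_cases hi : i = i₀
  · subst hi; simp [hw']
  · have : ¬ 0 < hH.eigenvalues i := fun hpos => hi (by
      have : i ∈ Finset.univ.filter fun i => 0 < hH.eigenvalues i := by simpa using hpos
      rw [hi₀] at this
      simpa using this)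
    exact mul_nonpos_of_nonpos_of_nonneg (not_lt.1 this) (sq_nonneg _)

/-- The reversed Cauchy-Schwarz inequality for a form that is nonpositive on a hyperplane. -/
theorem Matrix.IsSymm.mul_le_sq_of_nonpos_on_ker {B : Matrix V V ℝ} (hB : B.IsSymm)
    {φ : (V → ℝ) →ₗ[ℝ] ℝ} (hφ : ∀ w, φ w = 0 → w ⬝ᵥ B.mulVec w ≤ 0) {x : V → ℝ}
    (hx : 0 < x ⬝ᵥ B.mulVec x) (y : V → ℝ) :
    (x ⬝ᵥ B.mulVec x) * (y ⬝ᵥ B.mulVec y) ≤ (x ⬝ᵥ B.mulVec y) ^ 2 := by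
  have hb : φ x ≠ 0 := fun h => absurd (hφ x h) (not_le.2 hx)
  have hsymm : y ⬝ᵥ B.mulVec x = x ⬝ᵥ B.mulVec y := by
    rw [Matrix.dotProduct_mulVec, ← Matrix.mulVec_transpose, hB.eq, dotProduct_comm]
  -- This combination lies in the kernel of `φ`. Multiplying the result by `p` and completing the
  -- square isolates `p q - r²`.
  have h := hφ (φ y • x - φ x • y) (by simp [mul_comm])
  simp only [Matrix.mulVec_sub, Matrix.mulVec_smul, sub_dotProduct, dotProduct_sub,
    smul_dotProduct, dotProduct_smul, smul_eq_mul, hsymm] at h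
  set a := φ y
  set b := φ x
  set p := x ⬝ᵥ B.mulVec x
  set q := y ⬝ᵥ B.mulVec y
  set r := x ⬝ᵥ B.mulVec y
  have h1 : b ^ 2 * (p * q - r ^ 2) ≤ 0 := by
    have := mul_nonpos_of_nonneg_of_nonpos hx.le h
    nlinarith [sq_nonneg (a * p - b * r)]
  have h2 : p * q - r ^ 2 ≤ 0 := by
    by_contra! h3
    have := mul_pos (pow_pos (abs_pos.2 hb) 2) h3
    rw [sq_abs] at this
    linarith
  linarith

/-- For `z = x + iy` the value is `q(x) - q(y) + 2i b(x,y)`. If `q(y) ≤ 0` the real part suffices;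
otherwise reversed Cauchy-Schwarz makes the squared modulus at least `(q(x) + q(y))²`. -/
theorem Matrix.IsSymm.quadratic_re_le_norm {B : Matrix V V ℝ} (hB : B.IsSymm)
    (hnn : ∀ i j, 0 ≤ B i j) {φ : (V → ℝ) →ₗ[ℝ] ℝ}
    (hφ : ∀ w, φ w = 0 → w ⬝ᵥ B.mulVec w ≤ 0) {z : V → ℂ} (hz : ∀ j, 0 < (z j).re) :
    ∑ i, ∑ j, B i j * ((z i).re * (z j).re) ≤ ‖∑ i, ∑ j, (B i j : ℂ) * (z i * z j)‖ := by
  have hdot : ∀ x y : V → ℝ, x ⬝ᵥ B.mulVec y = ∑ i, ∑ j, B i j * (x i * y j) := fun x y => by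
    simp only [dotProduct, Matrix.mulVec, Finset.mul_sum]
    exact Finset.sum_congr rfl fun i _ => Finset.sum_congr rfl fun j _ => by ring
  set x : V → ℝ := fun j => (z j).re with hx
  set y : V → ℝ := fun j => (z j).im with hy
  have hsymm : y ⬝ᵥ B.mulVec x = x ⬝ᵥ B.mulVec y := by
    rw [Matrix.dotProduct_mulVec, ← Matrix.mulVec_transpose, hB.eq, dotProduct_comm]
  set Q := ∑ i, ∑ j, (B i j : ℂ) * (z i * z j) with hQ
  have hre : Q.re = x ⬝ᵥ B.mulVec x - y ⬝ᵥ B.mulVec y := by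
    rw [hdot, hdot, hQ, Complex.re_sum, ← Finset.sum_sub_distrib]
    refine Finset.sum_congr rfl fun i _ => ?_
    rw [Complex.re_sum, ← Finset.sum_sub_distrib]
    refine Finset.sum_congr rfl fun j _ => ?_
    rw [Complex.re_ofReal_mul, Complex.mul_re]
    ring
  have him : Q.im = 2 * (x ⬝ᵥ B.mulVec y) := by
    rw [two_mul]
    nth_rewrite 1 [← hsymm]
    rw [hdot, hdot, hQ, Complex.im_sum, ← Finset.sum_add_distrib]
    refine Finset.sum_congr rfl fun i _ => ?_
    rw [Complex.im_sum, ← Finset.sum_add_distrib]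
    refine Finset.sum_congr rfl fun j _ => ?_
    rw [Complex.im_ofReal_mul, Complex.mul_im]
    ring
  have hq : 0 ≤ x ⬝ᵥ B.mulVec x := by
    rw [hdot]
    exact Finset.sum_nonneg fun i _ => Finset.sum_nonneg fun j _ =>
      mul_nonneg (hnn i j) (mul_nonneg (hz i).le (hz j).le)
  change ∑ i, ∑ j, B i j * (x i * x j) ≤ _
  rw [← hdot]
  rcases hq.eq_or_lt with h0 | h0
  · rw [← h0]; exact norm_nonneg _
  by_cases hy0 : y ⬝ᵥ B.mulVec y ≤ 0
  · refine le_trans ?_ (Complex.re_le_norm Q)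
    rw [hre]
    linarith
  · have hcs := hB.mul_le_sq_of_nonpos_on_ker hφ h0 y
    refine (sq_le_sq₀ hq (norm_nonneg _)).1 ?_
    rw [Complex.sq_norm, Complex.normSq_apply, hre, him]
    nlinarith

end Lorentzian

/-! ### Stability of the edge form and of products -/

namespace MvPolynomial

theorem coeff_mul_nonneg {V : Type*} {p q : MvPolynomial V ℝ} (hp : ∀ m, 0 ≤ p.coeff m)
    (hq : ∀ m, 0 ≤ q.coeff m) (m : V →₀ ℕ) : 0 ≤ (p * q).coeff m := by
  classical
  rw [coeff_mul]
  exact Finset.sum_nonneg fun a _ => mul_nonneg (hp _) (hq _)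

theorem isStableForm_C {V : Type*} {a : ℝ} (ha : 0 ≤ a) : (C a : MvPolynomial V ℝ).IsStableForm 0 where
  coeff_nonneg m := by
    classical
    rw [coeff_C]
    split_ifs
    exacts [ha, le_rfl]
  isHomogeneous := isHomogeneous_C _ _
  le_norm_of_pos z _ := by
    rw [algHom_C, algHom_C]
    simpa using le_abs_self a

variable {V : Type*} [Fintype V]

theorem IsStableForm.mul {p q : MvPolynomial V ℝ} {e f : ℕ} (hp : p.IsStableForm e)
    (hq : q.IsStableForm f) : (p * q).IsStableForm (e + f) where
  coeff_nonneg := coeff_mul_nonneg hp.coeff_nonneg hq.coeff_nonneg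
  isHomogeneous := hp.isHomogeneous.mul hq.isHomogeneous
  le_norm_of_pos z hz := by
    rw [map_mul, map_mul, norm_mul]
    exact mul_le_mul (hp.le_norm_of_pos z hz) (hq.le_norm_of_pos z hz)
      (aeval_nonneg hq.coeff_nonneg fun j => (hz j).le) (norm_nonneg _)

theorem IsStableForm.pow {p : MvPolynomial V ℝ} {e : ℕ} (hp : p.IsStableForm e) (k : ℕ) :
    (p ^ k).IsStableForm (e * k) := by
  induction k with
  | zero => simpa using isStableForm_C (V := V) zero_le_one
  | succ k ih => rw [pow_succ, Nat.mul_succ]; exact ih.mul hp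

theorem isStableForm_sum_X : (∑ i, X i : MvPolynomial V ℝ).IsStableForm 1 where
  coeff_nonneg m := by
    classical
    rw [coeff_sum]
    refine Finset.sum_nonneg fun i _ => ?_
    rw [coeff_X]
    split_ifs <;> simp
  isHomogeneous := IsHomogeneous.sum _ _ _ fun i _ => isHomogeneous_X _ _
  le_norm_of_pos z _ := by
    simp only [map_sum, aeval_X]
    refine le_trans ?_ (Complex.re_le_norm _)
    rw [Complex.re_sum]

variable [LinearOrder V]

/-- The quadratic form `∑_{i < j} B i j * X i * X j`. -/
noncomputable def edgeForm (B : Matrix V V ℝ) : MvPolynomial V ℝ :=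
  ∑ e : V × V with e.1 < e.2, C (B e.1 e.2) * (X e.1 * X e.2)

theorem two_mul_aeval_edgeForm {A : Type*} [CommRing A] [Algebra ℝ A] {B : Matrix V V ℝ}
    (hB : B.IsSymm) (hdiag : ∀ i, B i i = 0) (w : V → A) :
    2 * aeval w (edgeForm B) = ∑ i, ∑ j, algebraMap ℝ A (B i j) * (w i * w j) := by
  set f : V × V → A := fun e => algebraMap ℝ A (B e.1 e.2) * (w e.1 * w e.2) with hf
  have h1 : aeval w (edgeForm B) = ∑ e : V × V with e.1 < e.2, f e := by
    simp [edgeForm, hf, algHom_C]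
  have h2 : ∑ e : V × V with e.2 < e.1, f e = ∑ e : V × V with e.1 < e.2, f e := by
    refine Finset.sum_bij' (fun e _ => e.swap) (fun e _ => e.swap) ?_ ?_ ?_ ?_ ?_
    · simp
    · simp
    · simp
    · simp
    · intro e _
      simp only [hf, Prod.fst_swap, Prod.snd_swap]
      rw [← hB.apply, mul_comm (w e.2)]
  have h3 : ∑ i, ∑ j, algebraMap ℝ A (B i j) * (w i * w j) = ∑ e : V × V, f e :=
    (Fintype.sum_prod_type (f := f)).symm
  rw [h3, ← Finset.sum_filter_add_sum_filter_not Finset.univ (fun e : V × V => e.1 < e.2), h1,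
    two_mul]
  congr 1
  rw [← h2]
  refine Finset.sum_subset (fun e he => ?_) fun e he he' => ?_
  · simp only [Finset.mem_filter, Finset.mem_univ, true_and] at he ⊢
    exact not_lt.2 he.le
  · simp only [Finset.mem_filter, Finset.mem_univ, true_and] at he he'
    have : e.1 = e.2 := le_antisymm (not_lt.1 he') (not_lt.1 he)
    simp [hf, this, hdiag]

theorem isStableForm_edgeForm {B : Matrix V V ℝ} (hB : B.IsSymm) (hdiag : ∀ i, B i i = 0)
    (hnn : ∀ i j, 0 ≤ B i j) {φ : (V → ℝ) →ₗ[ℝ] ℝ}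
    (hφ : ∀ w, φ w = 0 → w ⬝ᵥ B.mulVec w ≤ 0) : (edgeForm B).IsStableForm 2 where
  coeff_nonneg m := by
    have hX : ∀ (i : V) (m : V →₀ ℕ), 0 ≤ (X i : MvPolynomial V ℝ).coeff m := fun i m => by
      rw [coeff_X]
      split_ifs <;> simp
    rw [edgeForm, coeff_sum]
    refine Finset.sum_nonneg fun e _ => ?_
    rw [coeff_C_mul]
    exact mul_nonneg (hnn _ _) (coeff_mul_nonneg (hX _) (hX _) m)
  isHomogeneous := IsHomogeneous.sum _ _ _ fun e _ => by
    simpa using (isHomogeneous_C V (B e.1 e.2)).mul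
      ((isHomogeneous_X ℝ e.1).mul (isHomogeneous_X ℝ e.2))
  le_norm_of_pos z hz := by
    have h := hB.quadratic_re_le_norm hnn hφ hz
    have h1 := two_mul_aeval_edgeForm hB hdiag z
    have h2 := two_mul_aeval_edgeForm hB hdiag fun j => (z j).re
    simp only [Complex.coe_algebraMap, Algebra.algebraMap_self, RingHom.id_apply] at h1 h2
    rw [← h1, ← h2, norm_mul, Complex.norm_two] at h
    linarith

theorem degreeOf_edgeForm_le (B : Matrix V V ℝ) (i : V) : degreeOf i (edgeForm B) ≤ 1 := by
  refine (degreeOf_sum_le _ _ _).trans (Finset.sup_le fun e he => ?_)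
  refine (degreeOf_C_mul_le _ _ _).trans ((degreeOf_mul_le _ _ _).trans ?_)
  rw [degreeOf_X, degreeOf_X]
  have : e.1 ≠ e.2 := (by simpa using he : e.1 < e.2).ne
  split_ifs with h1 h2
  · exact absurd (h1.symm.trans h2) this
  all_goals simp

theorem degreeOf_sum_X_le (i : V) : degreeOf i (∑ j, X j : MvPolynomial V ℝ) ≤ 1 := by
  refine (degreeOf_sum_le _ _ _).trans (Finset.sup_le fun e he => ?_)
  rw [degreeOf_X]
  split_ifs <;> simp

end MvPolynomial

/-! ### Hafnians as coefficients -/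

theorem Finset.sum_pow_eq_factorial_mul_of_sq_zero {ι A : Type*} [DecidableEq ι] [CommRing A]
    (s : Finset ι) (w : ι → A) (hw : ∀ i ∈ s, w i * w i = 0) (k : ℕ) :
    (∑ i ∈ s, w i) ^ k = k.factorial * ∑ M ∈ s.powersetCard k, ∏ i ∈ M, w i := by
  induction s using Finset.induction_on generalizing k with
  | empty =>
    cases k with
    | zero => simp
    | succ k =>
      rw [Finset.powersetCard_eq_empty.2 (by simp)]
      simp
  | insert a s ha ih =>
    have ih := ih fun i hi => hw i (Finset.mem_insert_of_mem hi)
    have haa := hw a (Finset.mem_insert_self a s)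
    have hadd : ∀ (S : A) (k : ℕ), (w a + S) ^ (k + 1) = S ^ (k + 1) + (k + 1) * w a * S ^ k := by
      intro S k
      induction k with
      | zero => simp; ring
      | succ k ihk =>
        rw [pow_succ, ihk]
        push_cast
        linear_combination ((k : A) + 1) * S ^ k * haa
    cases k with
    | zero => simp
    | succ k =>
      rw [Finset.sum_insert ha, hadd, ih, ih, Finset.powersetCard_succ_insert ha,
        Finset.sum_union, Finset.sum_image]
      · have : ∀ M ∈ s.powersetCard k, ∏ i ∈ insert a M, w i = w a * ∏ i ∈ M, w i :=
          fun M hM => Finset.prod_insert fun h => ha ((Finset.mem_powersetCard.1 hM).1 h)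
        rw [Finset.sum_congr rfl this, ← Finset.mul_sum, Nat.factorial_succ]
        push_cast
        ring
      · intro M hM N hN h
        have hM' : a ∉ M := fun h => ha ((Finset.mem_powersetCard.1 hM).1 h)
        have hN' : a ∉ N := fun h => ha ((Finset.mem_powersetCard.1 hN).1 h)
        rw [← Finset.erase_insert hM', ← Finset.erase_insert hN']
        exact congrArg (fun t => Finset.erase t a) h
      · rw [Finset.disjoint_left]
        intro M hM hM'
        obtain ⟨N, _, rfl⟩ := Finset.mem_image.1 hM'
        exact ha ((Finset.mem_powersetCard.1 hM).1 (Finset.mem_insert_self a N))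

section Matchings

variable {V : Type*} [Fintype V] [LinearOrder V]

/-- The number of edges of `M` at the vertex `v`. -/
def edgeCount (M : Finset (V × V)) (v : V) : ℕ := (M.filter fun e => v = e.1 ∨ v = e.2).card

theorem sum_edgeCount {M : Finset (V × V)} (hM : ∀ e ∈ M, e.1 < e.2) :
    ∑ v, edgeCount M v = 2 * M.card := by
  simp only [edgeCount, Finset.card_filter]
  rw [Finset.sum_comm, mul_comm, ← smul_eq_mul, ← Finset.sum_const]
  refine Finset.sum_congr rfl fun e he => ?_
  rw [← Finset.card_filter]
  have : (Finset.univ.filter fun v => v = e.1 ∨ v = e.2) = {e.1, e.2} := by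
    ext v; simp
  rw [this, Finset.card_pair (hM e he).ne]

/-- Matchings of different vertex sets `S` become edge sets in one common type, so the sum over `S`
can be exchanged with the sum over edge sets. -/
theorem haf_submatrix_eq {R : Type*} [CommSemiring R] (B : Matrix V V R) (S : Finset V) :
    haf (B.submatrix (fun i : S => (i : V)) (fun i : S => (i : V))) =
      ∑ M : Finset (V × V) with (∀ e ∈ M, e.1 < e.2) ∧
        ∀ v, edgeCount M v = if v ∈ S then 1 else 0, ∏ e ∈ M, B e.1 e.2 := by
  let ι : S × S ↪ V × V := (Function.Embedding.subtype _).prodMap (Function.Embedding.subtype _)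
  have hι : ∀ e, ι e = ((e.1 : V), (e.2 : V)) := fun e => rfl
  have hcount : ∀ (M : Finset (S × S)) (v : S), edgeCount (M.map ι) (v : V) = edgeCount M v := by
    intro M v
    rw [edgeCount, Finset.filter_map, Finset.card_map, edgeCount]
    congr 2
    ext e
    exact or_congr Subtype.ext_iff.symm Subtype.ext_iff.symm
  rw [haf]
  refine Finset.sum_bij (fun M _ => M.map ι) ?_ ?_ ?_ ?_
  · intro M hM
    simp only [perfectMatchings, Finset.mem_filter, Finset.mem_univ, true_and] at hM ⊢
    refine ⟨?_, fun v => ?_⟩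
    · intro e he
      obtain ⟨e', he', rfl⟩ := Finset.mem_map.1 he
      exact hM.1 e' he'
    · split_ifs with hv
      · rw [hcount M ⟨v, hv⟩]
        exact hM.2 ⟨v, hv⟩
      · rw [edgeCount, Finset.card_eq_zero, Finset.filter_eq_empty_iff]
        intro e he
        obtain ⟨e', _, rfl⟩ := Finset.mem_map.1 he
        rintro (h | h)
        · exact hv (h ▸ e'.1.2)
        · exact hv (h ▸ e'.2.2)
  · intro M _ N _ h
    exact Finset.map_injective ι h
  · intro M hM
    simp only [Finset.mem_filter, Finset.mem_univ, true_and] at hM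
    have hmem : ∀ e ∈ M, ∀ v, v = e.1 ∨ v = e.2 → v ∈ S := by
      intro e he v hv
      by_contra hvS
      have := hM.2 v
      rw [if_neg hvS, edgeCount, Finset.card_eq_zero, Finset.filter_eq_empty_iff] at this
      exact this he hv
    have hmap : (Finset.univ.filter fun e : S × S => ι e ∈ M).map ι = M := by
      ext e
      simp only [Finset.mem_map, Finset.mem_filter, Finset.mem_univ, true_and]
      constructor
      · rintro ⟨e', he', rfl⟩; exact he'
      · intro he
        exact ⟨(⟨e.1, hmem e he _ (Or.inl rfl)⟩, ⟨e.2, hmem e he _ (Or.inr rfl)⟩), he, rfl⟩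
    refine ⟨Finset.univ.filter fun e : S × S => ι e ∈ M, ?_, hmap⟩
    simp only [perfectMatchings, Finset.mem_filter, Finset.mem_univ, true_and]
    refine ⟨fun e he => hM.1 _ he, fun v => ?_⟩
    have h1 := hcount (Finset.univ.filter fun e : S × S => ι e ∈ M) v
    rw [hmap, hM.2, if_pos v.2] at h1
    exact h1.symm
  · intro M _
    rw [Finset.prod_map]
    rfl

theorem hafK_eq_sum {R : Type*} [CommSemiring R] (B : Matrix V V R) {k l : ℕ}
    (hkl : 2 * k + l = Fintype.card V) :
    hafK k B = ∑ M ∈ (Finset.univ.filter fun e : V × V => e.1 < e.2).powersetCard k,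
      ∑ T ∈ (Finset.univ : Finset V).powersetCard l,
        if ∀ v, edgeCount M v + (if v ∈ T then 1 else 0) = 1 then ∏ e ∈ M, B e.1 e.2 else 0 := by
  rw [hafK, Finset.sum_comm]
  -- `T` is the set of vertices left uncovered by the matching.
  refine Finset.sum_bij' (fun S _ => Sᶜ) (fun T _ => Tᶜ) ?_ ?_ ?_ ?_ ?_
  · intro S hS
    rw [Finset.mem_powersetCard_univ] at hS ⊢
    rw [Finset.card_compl, hS]
    omega
  · intro S hS
    rw [Finset.mem_powersetCard_univ] at hS ⊢
    rw [Finset.card_compl, hS]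
    omega
  · simp
  · simp
  · intro S hS
    rw [Finset.mem_powersetCard_univ] at hS
    rw [haf_submatrix_eq, ← Finset.sum_filter]
    refine Finset.sum_congr ?_ fun _ _ => rfl
    ext M
    have hiff : (∀ v, edgeCount M v + (if v ∈ Sᶜ then 1 else 0) = 1) ↔
        ∀ v, edgeCount M v = if v ∈ S then 1 else 0 := by
      refine forall_congr' fun v => ?_
      by_cases hv : v ∈ S <;> simp [hv]
    simp only [Finset.mem_filter, Finset.mem_univ, true_and, Finset.mem_powersetCard, hiff]
    constructor
    · rintro ⟨h1, h2⟩
      refine ⟨⟨fun e he => by simpa using h1 e he, ?_⟩, h2⟩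
      have := sum_edgeCount h1
      rw [Finset.sum_congr rfl fun v _ => h2 v] at this
      simp only [Finset.sum_ite_mem, Finset.univ_inter, Finset.sum_const, smul_eq_mul,
        mul_one] at this
      omega
    · rintro ⟨⟨h1, _⟩, h2⟩
      exact ⟨fun e he => by simpa using h1 he, h2⟩

end Matchings

namespace MvPolynomial

variable {V : Type*} [Fintype V] [LinearOrder V]

/-- The ideal generated by the squares of the variables. -/
noncomputable def squaresIdeal (V : Type*) : Ideal (MvPolynomial V ℝ) :=
  Ideal.span ((fun s => monomial s (1 : ℝ)) '' Set.range fun i : V => Finsupp.single i 2)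

theorem X_mul_X_mem_squaresIdeal {V : Type*} (i : V) :
    (X i * X i : MvPolynomial V ℝ) ∈ squaresIdeal V := by
  refine Ideal.subset_span ⟨Finsupp.single i 2, ⟨i, rfl⟩, ?_⟩
  rw [← pow_two, X_pow_eq_monomial]

/-- Every monomial of an element of the ideal is divisible by some `X i ^ 2`, so squarefree
coefficients survive in the quotient. -/
theorem coeff_eq_of_mk_eq {V : Type*} {p q : MvPolynomial V ℝ}
    (h : Ideal.Quotient.mk (squaresIdeal V) p = Ideal.Quotient.mk (squaresIdeal V) q)
    {m : V →₀ ℕ} (hm : ∀ i, m i ≤ 1) : p.coeff m = q.coeff m := by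
  rw [Ideal.Quotient.eq, squaresIdeal, mem_ideal_span_monomial_image] at h
  by_contra hne
  obtain ⟨_, ⟨i, rfl⟩, hi⟩ := h m (by
    rw [mem_support_iff, coeff_sub]
    exact sub_ne_zero.2 hne)
  have h1 := hi i
  have h2 := hm i
  simp at h1
  omega

theorem coeff_matching_monomial (B : Matrix V V ℝ) {M : Finset (V × V)}
    (hM : ∀ e ∈ M, e.1 < e.2) (T : Finset V) :
    ((∏ e ∈ M, C (B e.1 e.2) * (X e.1 * X e.2)) * ∏ i ∈ T, X i : MvPolynomial V ℝ).coeff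
        (∑ j, Finsupp.single j 1) =
      if ∀ v, edgeCount M v + (if v ∈ T then 1 else 0) = 1 then ∏ e ∈ M, B e.1 e.2 else 0 := by
  have h1 : ((∏ e ∈ M, C (B e.1 e.2) * (X e.1 * X e.2)) * ∏ i ∈ T, X i : MvPolynomial V ℝ) =
      monomial ((∑ e ∈ M, (Finsupp.single e.1 1 + Finsupp.single e.2 1)) +
        ∑ i ∈ T, Finsupp.single i 1) (∏ e ∈ M, B e.1 e.2) := by
    have e1 : ∀ e : V × V, (C (B e.1 e.2) * (X e.1 * X e.2) : MvPolynomial V ℝ) =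
        monomial (Finsupp.single e.1 1 + Finsupp.single e.2 1) (B e.1 e.2) := fun e => by
      simp only [X, C_mul_monomial, monomial_mul, mul_one]
    have e2 : (∏ i ∈ T, X i : MvPolynomial V ℝ) = monomial (∑ i ∈ T, Finsupp.single i 1) 1 :=
      (monomial_sum_one T fun i => Finsupp.single i 1).symm
    rw [Finset.prod_congr rfl fun e _ => e1 e, e2, ← monomial_sum_prod, monomial_mul, mul_one]
  rw [h1, coeff_monomial]
  congr 1
  rw [Finsupp.ext_iff]
  refine propext (forall_congr' fun v => ?_)
  have hl : ((∑ e ∈ M, (Finsupp.single e.1 1 + Finsupp.single e.2 1)) +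
      ∑ i ∈ T, Finsupp.single i 1 : V →₀ ℕ) v = edgeCount M v + (if v ∈ T then 1 else 0) := by
    rw [Finsupp.add_apply, Finsupp.finsetSum_apply, Finsupp.finsetSum_apply]
    congr 1
    · rw [edgeCount, Finset.card_filter]
      refine Finset.sum_congr rfl fun e he => ?_
      have := (hM e he).ne
      rw [Finsupp.add_apply, Finsupp.single_apply, Finsupp.single_apply]
      by_cases h1 : v = e.1
      · subst h1
        simp [this.symm]
      · simp [h1, Ne.symm h1, eq_comm]
    · simp [Finsupp.single_apply]
  have hr : (∑ j, Finsupp.single j 1 : V →₀ ℕ) v = 1 := by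
    rw [Finsupp.finsetSum_apply]
    simp [Finsupp.single_apply]
  rw [hl, hr]

/-- Modulo the squares of the variables, edge terms and variables square to zero, so both powers
expand over subsets with factors `k!` and `l!`. The full squarefree monomial then selects a matching
together with its uncovered vertices. -/
theorem coeff_edgeForm_pow_mul (B : Matrix V V ℝ) {k l : ℕ}
    (hkl : 2 * k + l = Fintype.card V) :
    (edgeForm B ^ k * (∑ i, X i) ^ l).coeff (∑ j, Finsupp.single j 1) =
      k.factorial * l.factorial * hafK k B := by
  set π := Ideal.Quotient.mk (squaresIdeal V) with hπ
  have hX : ∀ i : V, π (X i) * π (X i) = 0 := fun i => by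
    rw [← map_mul]
    exact Ideal.Quotient.eq_zero_iff_mem.2 (X_mul_X_mem_squaresIdeal i)
  set E := Finset.univ.filter fun e : V × V => e.1 < e.2 with hE
  set q : MvPolynomial V ℝ := C ((k.factorial : ℝ) * l.factorial) * ∑ M ∈ E.powersetCard k,
    ∑ T ∈ (Finset.univ : Finset V).powersetCard l,
      (∏ e ∈ M, C (B e.1 e.2) * (X e.1 * X e.2)) * ∏ i ∈ T, X i with hq
  have hmk : π (edgeForm B ^ k * (∑ i, X i) ^ l) = π q := by
    have h1 := Finset.sum_pow_eq_factorial_mul_of_sq_zero E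
      (fun e => π (C (B e.1 e.2) * (X e.1 * X e.2))) (fun e _ => by
        simp only [map_mul]
        linear_combination (π (C (B e.1 e.2)) * π (X e.2)) ^ 2 * hX e.1) k
    have h2 := Finset.sum_pow_eq_factorial_mul_of_sq_zero (Finset.univ : Finset V)
      (fun i => π (X i)) (fun i _ => hX i) l
    rw [map_mul, map_pow, map_pow, edgeForm, map_sum, map_sum, h1, h2, hq]
    simp only [map_mul, map_sum, map_prod, map_natCast]
    rw [← Finset.sum_mul_sum]
    ring
  rw [coeff_eq_of_mk_eq hmk, hq, coeff_C_mul, coeff_sum, hafK_eq_sum B hkl]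
  · congr 1
    refine Finset.sum_congr rfl fun M hM => ?_
    rw [coeff_sum]
    refine Finset.sum_congr rfl fun T _ => ?_
    exact coeff_matching_monomial B
      (fun e he => by simpa [hE] using (Finset.mem_powersetCard.1 hM).1 he) T
  · intro i
    rw [Finsupp.finsetSum_apply]
    simp [Finsupp.single_apply]

end MvPolynomial

/-! ### The constant and the capacity of the polynomial -/

theorem prod_range_capacityFactor (d : ℕ) :
    ∏ k ∈ Finset.range d, capacityFactor (k + 1) = (d.factorial : ℝ) / (d : ℝ) ^ d := by
  induction d with
  | zero => simp
  | succ d ih =>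
    rw [Finset.prod_range_succ, ih, capacityFactor, Nat.add_sub_cancel, Nat.factorial_succ]
    push_cast
    rw [add_sub_cancel_right]
    rcases Nat.eq_zero_or_pos d with rfl | hd
    · simp
    · have : (0 : ℝ) < d := by exact_mod_cast hd
      rw [div_pow, pow_succ]
      field_simp

theorem prod_range_capacityFactor_min (d r : ℕ) :
    ∏ k ∈ Finset.range (d + r), capacityFactor (min d (k + 1)) =
      (d.factorial : ℝ) / (d : ℝ) ^ d * capacityFactor d ^ r := by
  rw [Finset.prod_range_add, ← prod_range_capacityFactor]
  congr 1
  · refine Finset.prod_congr rfl fun k hk => ?_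
    rw [min_eq_right (Finset.mem_range.1 hk)]
  · rw [Finset.prod_congr rfl fun k _ => by rw [min_eq_left (by omega)], Finset.prod_const,
      Finset.card_range]

section Capacity

variable {V : Type*} [Fintype V]

theorem card_mul_geom_mean_le_sum [Nonempty V] {x : V → ℝ} (hx : ∀ j, 0 < x j) :
    Fintype.card V * (∏ j, x j) ^ (Fintype.card V : ℝ)⁻¹ ≤ ∑ j, x j := by
  have hN : (0 : ℝ) < Fintype.card V := by exact_mod_cast Fintype.card_pos
  have h := Real.geom_mean_le_arith_mean_weighted Finset.univ
    (fun _ : V => (Fintype.card V : ℝ)⁻¹) x (fun _ _ => by positivity)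
    (by simp) fun j _ => (hx j).le
  rw [Real.finsetProd_rpow _ _ fun j _ => (hx j).le, ← Finset.mul_sum, inv_mul_eq_div,
    le_div_iff₀ hN] at h
  linarith

/-- Weighted AM-GM over pairs with weights `B i j / N`: row and column sums equal to one give each
variable total exponent `2 / N`. -/
theorem card_mul_geom_mean_sq_le_sum [Nonempty V] {B : Matrix V V ℝ} (hB : B.IsSymm)
    (hnn : ∀ i j, 0 ≤ B i j) (hrow : ∀ i, ∑ j, B i j = 1) {x : V → ℝ} (hx : ∀ j, 0 < x j) :
    Fintype.card V * ((∏ j, x j) ^ (Fintype.card V : ℝ)⁻¹) ^ 2 ≤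
      ∑ i, ∑ j, B i j * (x i * x j) := by
  set N : ℝ := (Fintype.card V : ℝ) with hNdef
  have hN : (0 : ℝ) < N := by rw [hNdef]; exact_mod_cast Fintype.card_pos
  have hcol : ∀ j, ∑ i, B i j = 1 := fun j => by
    rw [← hrow j]
    exact Finset.sum_congr rfl fun i _ => hB.apply j i
  have h := Real.geom_mean_le_arith_mean_weighted Finset.univ
    (fun e : V × V => B e.1 e.2 / N) (fun e => x e.1 * x e.2)
    (fun e _ => div_nonneg (hnn _ _) hN.le) (by
      rw [Fintype.sum_prod_type, ← Fintype.sum_congr _ _ fun i => Finset.sum_div _ _ _]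
      simp_rw [hrow, one_div]
      simp [← hNdef, hN.ne']) fun e _ => (mul_pos (hx _) (hx _)).le
  have hprod : ∏ e : V × V, (x e.1 * x e.2) ^ (B e.1 e.2 / N) = ((∏ j, x j) ^ N⁻¹) ^ 2 := by
    rw [Fintype.prod_prod_type]
    simp only
    simp_rw [Real.mul_rpow (hx _).le (hx _).le, Finset.prod_mul_distrib]
    rw [pow_two]
    congr 1
    · rw [← Real.finsetProd_rpow _ _ fun j _ => (hx j).le]
      refine Finset.prod_congr rfl fun i _ => ?_
      rw [← Real.rpow_sum_of_pos (hx i), ← Finset.sum_div, hrow, one_div]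
    · rw [← Real.finsetProd_rpow _ _ fun j _ => (hx j).le, Finset.prod_comm]
      refine Finset.prod_congr rfl fun i _ => ?_
      rw [← Real.rpow_sum_of_pos (hx i), ← Finset.sum_div, hcol, one_div]
  rw [hprod, Fintype.sum_prod_type] at h
  calc N * ((∏ j, x j) ^ N⁻¹) ^ 2 ≤ N * ∑ i, ∑ j, B i j / N * (x i * x j) :=
        mul_le_mul_of_nonneg_left h hN.le
    _ = _ := by
      simp_rw [Finset.mul_sum]
      refine Finset.sum_congr rfl fun i _ => Finset.sum_congr rfl fun j _ => ?_
      field_simp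

open MvPolynomial in
theorem le_hafK_of_lorentzian [LinearOrder V] {B : Matrix V V ℝ} (hB : B.IsSymm)
    (hdiag : ∀ i, B i i = 0) (hnn : ∀ i j, 0 ≤ B i j) (hrow : ∀ i, ∑ j, B i j = 1)
    {φ : (V → ℝ) →ₗ[ℝ] ℝ} (hφ : ∀ w, φ w = 0 → w ⬝ᵥ B.mulVec w ≤ 0) {k l : ℕ}
    (hkl : 2 * k + l = Fintype.card V) (hpos : 0 < k + l) :
    ((Fintype.card V : ℝ) / 2) ^ k * (Fintype.card V : ℝ) ^ l *
      (((k + l).factorial : ℝ) / ((k + l : ℕ) : ℝ) ^ (k + l) * capacityFactor (k + l) ^ k) ≤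
      k.factorial * l.factorial * hafK k B := by
  have : Nonempty V := Fintype.card_pos_iff.1 (by omega)
  set N : ℝ := (Fintype.card V : ℝ) with hNdef
  have hN : (0 : ℝ) < N := by rw [hNdef]; exact_mod_cast Fintype.card_pos
  have hst : (edgeForm B ^ k * (∑ i, X i) ^ l).IsStableForm (Finset.univ : Finset V).card := by
    have := ((isStableForm_edgeForm hB hdiag hnn hφ).pow k).mul (isStableForm_sum_X.pow l)
    rwa [one_mul, hkl] at this
  -- Every one of the `k + l` factors has degree at most one in each variable, which improves on the
  -- total degree `2k + l`.
  have hdeg : ∀ m ∈ (edgeForm B ^ k * (∑ i, X i) ^ l).support, ∀ i, m i ≤ k + l := by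
    intro m hm i
    refine degreeOf_le_iff.1 ?_ m hm
    refine (degreeOf_mul_le _ _ _).trans (add_le_add ?_ ?_)
    · exact (degreeOf_pow_le _ _ _).trans
        (by simpa using Nat.mul_le_mul_left k (degreeOf_edgeForm_le B i))
    · exact (degreeOf_pow_le _ _ _).trans
        (by simpa using Nat.mul_le_mul_left l (degreeOf_sum_X_le i))
  have hcap : ∀ x : V → ℝ, (∀ j, 0 < x j) → (N / 2) ^ k * N ^ l * ∏ j, x j ≤
      aeval x (edgeForm B ^ k * (∑ i, X i) ^ l) := by
    intro x hx
    have h1 := card_mul_geom_mean_le_sum hx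
    have h2 := card_mul_geom_mean_sq_le_sum hB hnn hrow hx
    have h3 := two_mul_aeval_edgeForm hB hdiag x
    simp only [Algebra.algebraMap_self, RingHom.id_apply] at h3
    rw [← hNdef] at h1 h2
    have hP : 0 < ∏ j, x j := Finset.prod_pos fun j _ => hx j
    set G := (∏ j, x j) ^ N⁻¹ with hG
    have hG0 : 0 < G := Real.rpow_pos_of_pos hP _
    have hGN : ∏ j, x j = (G ^ 2) ^ k * G ^ l := by
      rw [← pow_mul, ← pow_add, hkl, hG, hNdef,
        Real.rpow_inv_natCast_pow hP.le Fintype.card_ne_zero]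
    rw [← h3] at h2
    rw [map_mul, map_pow, map_pow, map_sum, hGN]
    simp only [aeval_X]
    calc (N / 2) ^ k * N ^ l * ((G ^ 2) ^ k * G ^ l) = (N / 2 * G ^ 2) ^ k * (N * G) ^ l := by
          rw [mul_pow, mul_pow]; ring
      _ ≤ _ := by
        have h4 : N / 2 * G ^ 2 ≤ aeval x (edgeForm B) := by linarith
        have h5 : 0 ≤ aeval x (edgeForm B) := le_trans (by positivity) h4
        gcongr
  have key := IsStableForm.capacity_mul_prod_le_coeff (k + l) hpos Finset.univ _ hst hdeg
    ((N / 2) ^ k * N ^ l) (by positivity) hcap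
  rw [coeff_edgeForm_pow_mul B hkl, Finset.card_univ, ← hkl,
    show 2 * k + l = (k + l) + k by ring, prod_range_capacityFactor_min] at key
  exact key

end Capacity

/-! ### The bounds for matrices in `Psi n` -/

theorem mem_Psi_properties {n : ℕ} {B : Matrix (Fin (2 * n)) (Fin (2 * n)) ℝ} (hB : B ∈ Psi n) :
    B.IsSymm ∧ (∀ i, B i i = 0) ∧ (∀ i j, 0 ≤ B i j) ∧ ∀ i, ∑ j, B i j = 1 := by
  let S : Set (Matrix (Fin (2 * n)) (Fin (2 * n)) ℝ) :=
    {B | B.IsSymm ∧ (∀ i, B i i = 0) ∧ (∀ i j, 0 ≤ B i j) ∧ ∀ i, ∑ j, B i j = 1}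
  have hS : Convex ℝ S := by
    rintro P ⟨h1, h2, h3, h4⟩ Q ⟨g1, g2, g3, g4⟩ a b ha hb hab
    refine ⟨(h1.smul a).add (g1.smul b), fun i => ?_, fun i j => ?_, fun i => ?_⟩
    · simp [h2, g2]
    · simp only [Matrix.add_apply, Matrix.smul_apply, smul_eq_mul]
      exact add_nonneg (mul_nonneg ha (h3 i j)) (mul_nonneg hb (g3 i j))
    · simp only [Matrix.add_apply, Matrix.smul_apply, smul_eq_mul]
      rw [Finset.sum_add_distrib, ← Finset.mul_sum, ← Finset.mul_sum, h4, g4]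
      simpa using hab
  refine convexHull_min (fun P hP => ?_) hS hB
  obtain ⟨⟨σ, rfl⟩, hsymm, hdiag⟩ := hP
  refine ⟨hsymm, hdiag, fun i j => ?_, fun i => ?_⟩
  · simp only [Equiv.Perm.permMatrix, PEquiv.toMatrix_apply]
    split_ifs <;> simp
  · simp [Equiv.Perm.permMatrix, PEquiv.toMatrix_apply]

theorem le_hafK_of_mem_Psi {n : ℕ} (hn : 1 ≤ n) {B : Matrix (Fin (2 * n)) (Fin (2 * n)) ℝ}
    (hB : B ∈ Psi n) (h : HasExactlyOnePosEigenvalue B) {k : ℕ} (hk : k ≤ n) :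
    ((2 * n : ℝ) ^ (2 * n - 2 * k) * ((2 * n - k).factorial : ℝ) * (2 * n : ℝ) ^ k) /
        (((2 * n - 2 * k).factorial : ℝ) * (2 * n - k : ℝ) ^ (2 * n - k) *
          2 ^ k * (k.factorial : ℝ)) *
      ((2 * n - k - 1 : ℝ) / (2 * n - k : ℝ)) ^ ((2 * n - k - 1) * k) ≤ hafK k B := by
  obtain ⟨h1, h2, h3, h4⟩ := mem_Psi_properties hB
  obtain ⟨φ, hφ⟩ := h.exists_nonpos_on_ker h1
  have key := le_hafK_of_lorentzian h1 h2 h3 h4 hφ (k := k) (l := 2 * n - 2 * k)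
    (by rw [Fintype.card_fin]; omega) (by omega)
  have hd : k + (2 * n - 2 * k) = 2 * n - k := by omega
  have hcast : ((2 * n - k : ℕ) : ℝ) = 2 * n - k := by
    rw [Nat.cast_sub (by omega)]; push_cast; ring
  rw [hd, Fintype.card_fin, capacityFactor, hcast, ← pow_mul] at key
  push_cast at key
  have hnn : (0 : ℝ) < 2 * n - k := by
    rw [← hcast]; exact_mod_cast (show 0 < 2 * n - k by omega)
  have hkf : (0 : ℝ) < k.factorial := by exact_mod_cast k.factorial_pos
  have hlf : (0 : ℝ) < (2 * n - 2 * k).factorial := by exact_mod_cast Nat.factorial_pos _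
  refine le_of_mul_le_mul_left (le_of_eq_of_le ?_ key) (mul_pos hkf hlf)
  rw [mul_div_cancel_left₀ _ (two_ne_zero' ℝ), mul_pow (2 : ℝ) (n : ℝ) k]
  field_simp

/-! ### Asymptotics and conclusion -/

theorem abs_log_ratio_exponent_le {n : ℕ} (hn : 2 ≤ n) :
    |(n : ℝ) * (n - 1) * Real.log (1 - (n : ℝ)⁻¹) + n - 1 / 2| ≤ 2 / n := by
  have hn2 : (2 : ℝ) ≤ n := by exact_mod_cast hn
  have hn0 : (0 : ℝ) < n := by linarith
  have hx0 : 0 < (n : ℝ)⁻¹ := by positivity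
  have hx1 : (n : ℝ)⁻¹ < 1 := inv_lt_one_of_one_lt₀ (by linarith)
  have h := Real.abs_log_sub_add_sum_range_le (x := (n : ℝ)⁻¹) (by rwa [abs_of_pos hx0]) 2
  rw [abs_of_pos hx0] at h
  simp only [Finset.sum_range_succ, Finset.sum_range_zero] at h
  norm_num at h
  set δ := (n : ℝ)⁻¹ + ((n : ℝ) ^ 2)⁻¹ / 2 + Real.log (1 - (n : ℝ)⁻¹) with hδ
  have hδ' : |(n : ℝ) * (n - 1) * δ| ≤ 1 / n := by
    rw [abs_mul, abs_of_nonneg (mul_nonneg hn0.le (by linarith))]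
    refine (mul_le_mul_of_nonneg_left h (mul_nonneg hn0.le (by linarith))).trans_eq ?_
    have : (n : ℝ) - 1 ≠ 0 := by linarith
    field_simp
  -- `δ` is the second-order Taylor remainder of `log (1 - 1/n)`; the main terms contribute `-n +
  -- 1/2 + 1/(2n)`.
  have he : (n : ℝ) * (n - 1) * Real.log (1 - (n : ℝ)⁻¹) + n - 1 / 2 =
      1 / (2 * n) + n * (n - 1) * δ := by
    rw [hδ]
    field_simp
    ring
  rw [he]
  refine (abs_add_le _ _).trans ?_
  rw [abs_of_pos (by positivity)]
  have : 1 / (2 * (n : ℝ)) ≤ 1 / n := by gcongr; linarith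
  calc _ ≤ 1 / (n : ℝ) + 1 / n := add_le_add this hδ'
    _ = 2 / n := by ring

theorem isEquivalent_sub_one_div_pow :
    Asymptotics.IsEquivalent Filter.atTop
      (fun n : ℕ => (((n : ℝ) - 1) / n) ^ ((n - 1) * n))
      (fun n : ℕ => Real.exp (-(n : ℝ)) * Real.sqrt (Real.exp 1)) := by
  refine Asymptotics.isEquivalent_of_tendsto_one ?_
  have h0 : Filter.Tendsto
      (fun n : ℕ => (n : ℝ) * (n - 1) * Real.log (1 - (n : ℝ)⁻¹) + n - 1 / 2)
      Filter.atTop (nhds 0) := by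
    refine squeeze_zero_norm' ?_ (tendsto_const_div_atTop_nhds_zero_nat 2)
    filter_upwards [Filter.eventually_ge_atTop 2] with n hn
    exact abs_log_ratio_exponent_le hn
  have h1 := (Real.continuous_exp.tendsto 0).comp h0
  rw [Real.exp_zero] at h1
  refine h1.congr' ?_
  filter_upwards [Filter.eventually_ge_atTop 2] with n hn
  have hn2 : (2 : ℝ) ≤ n := by exact_mod_cast hn
  have hpos : 0 < 1 - (n : ℝ)⁻¹ := sub_pos.2 (inv_lt_one_of_one_lt₀ (by linarith))
  have hbase : ((n : ℝ) - 1) / n = Real.exp (Real.log (1 - (n : ℝ)⁻¹)) := by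
    rw [Real.exp_log hpos]
    field_simp
  simp only [Function.comp_apply, Pi.div_apply]
  rw [hbase, ← Real.exp_nat_mul, ← Real.exp_half, ← Real.exp_add, ← Real.exp_sub]
  congr 1
  push_cast [Nat.cast_sub (show 1 ≤ n by omega)]
  ring

theorem theorem2p2 :
    (∀ (n : ℕ), 1 ≤ n → ∀ B ∈ Psi n, HasExactlyOnePosEigenvalue B →
      (((n : ℝ) - 1) / n) ^ ((n - 1) * n) ≤ hafK n B ∧
      ∀ k : ℕ, 2 ≤ k → k ≤ n - 1 →
        ((2 * n : ℝ) ^ (2 * n - 2 * k) * ((2 * n - k).factorial : ℝ) * (2 * n : ℝ) ^ k) /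
            (((2 * n - 2 * k).factorial : ℝ) * (2 * n - k : ℝ) ^ (2 * n - k) *
              2 ^ k * (k.factorial : ℝ)) *
          ((2 * n - k - 1 : ℝ) / (2 * n - k : ℝ)) ^ ((2 * n - k - 1) * k) ≤ hafK k B) ∧
    Asymptotics.IsEquivalent Filter.atTop
      (fun n : ℕ => (((n : ℝ) - 1) / n) ^ ((n - 1) * n))
      (fun n : ℕ => Real.exp (-(n : ℝ)) * Real.sqrt (Real.exp 1)) := by
  refine ⟨fun n hn B hB h => ⟨?_, fun k _ hk => le_hafK_of_mem_Psi hn hB h (by omega)⟩,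
    isEquivalent_sub_one_div_pow⟩
  -- The general bound also holds for `k = n`, where its prefactor collapses to `1`.
  refine le_of_eq_of_le ?_ (le_hafK_of_mem_Psi hn hB h le_rfl)
  have hn0 : (0 : ℝ) < n := by exact_mod_cast hn
  have hf : (0 : ℝ) < n.factorial := by exact_mod_cast n.factorial_pos
  have e1 : 2 * n - n = n := by omega
  have e2 : (2 * n - n : ℝ) = n := by ring
  rw [e1, e2, Nat.sub_self, pow_zero, Nat.factorial_zero, Nat.cast_one, one_mul, one_mul, mul_pow]
  have e3 :
      (n.factorial : ℝ) * (2 ^ n * (n : ℝ) ^ n) / ((n : ℝ) ^ n * 2 ^ n * n.factorial) = 1 := by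
    field_simp
  rw [e3, one_mul]
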